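/- For an integer $n\ge 4$ and residues $a,b,c,k\in\mathbb Z_n$, let $\mathcal N(n;a,b,c;k)$ be the graph with vertices $u_i,v_i$ ($i\in\mathbb Z_n$) and edges $u_iu_{i+1}$, $v_iv_{i+k}$, $u_iv_i$, $u_iv_{i+a}$, $u_iv_{i+b}$, $u_iv_{i+c}$ ($i\in\mathbb Z_n$), all indices being computed modulo $n$. A graph is half-arc-transitive if its automorphism group is transitive on vertices and on edges but not on arcs (ordered pairs of adjacent vertices). For a half-arc-transitive graph, an orbit of the automorphism group on the arcs is an orientation of the edges (there are two such orientations, opposite to each other); fix either of them. An edge $f$ is reachable from an edge $e$ if there is an alternating walk (any two consecutive edges are traversed in opposite directions with respect to the orientation) whose starting and terminal edges are $e$ and $f$. This is an equivalence relation on the edge set, called the reachability relation; its classes are called alternets, and it is universal if there is only one class. **Theorem.** Let $\Gamma=\mathcal N(2m;1,b,b+m+1;m-1)$, where $b=4b_0-1$ for some integer $b_0>1$ and $m>2$ is an even divisor of $b^2+3$ with $m\equiv 2\pmod 4$ and $b<2m$. Then $\Gamma$ is a half-arc-transitive graph of valence $6$. For either of the two orientations, the reachability relation of $\Gamma$ is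 an equivalence relation; it is universal if and only if $3$ does not divide $m$, while if $3$ divides $m$, then $\Gamma$ has exactly three alternets. Moreover, there are infinitely many pairwise non-isomorphic graphs $\Gamma$ of this form whose reachability relation is universal: for every $N$ there is one with more than $N$ vertices. In particular, there is an infinite family of half-arc-transitive graphs of valence $6$ with universal reachability relation. -/

import Mathlib

/-- The relation whose symmetrization is the adjacency of the Nest graph `N(n; a, b, c; k)`.
The vertices `u_i` are `Sum.inl i` and the vertices `v_i` are `Sum.inr i`, for `i` in `ℤ/n`. -/
def nestRel (n : ℕ) (a b c k : ZMod n) : ZMod n ⊕ ZMod n → ZMod n ⊕ ZMod n → Prop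
  | Sum.inl i, Sum.inl j => j = i + 1
  | Sum.inr i, Sum.inr j => j = i + k
  | Sum.inl i, Sum.inr j => j = i ∨ j = i + a ∨ j = i + b ∨ j = i + c
  | Sum.inr _, Sum.inl _ => False

/-- The Nest graph `N(n; a, b, c; k)`; all computations take place modulo `n`. -/
def nestGraph (n : ℕ) (a b c k : ZMod n) : SimpleGraph (ZMod n ⊕ ZMod n) :=
  SimpleGraph.fromRel (nestRel n a b c k)

section Symmetry

/-- The automorphism group acts transitively on the vertices. -/
def IsVertexTransitive {V : Type*} (G : SimpleGraph V) : Prop :=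
  ∀ x y : V, ∃ φ : G ≃g G, φ x = y

/-- The automorphism group acts transitively on the (undirected) edges. -/
def IsEdgeTransitive {V : Type*} (G : SimpleGraph V) : Prop :=
  ∀ e ∈ G.edgeSet, ∀ f ∈ G.edgeSet, ∃ φ : G ≃g G, Sym2.map φ e = f

/-- The automorphism group acts transitively on the arcs (ordered pairs of adjacent vertices). -/
def IsArcTransitive {V : Type*} (G : SimpleGraph V) : Prop :=
  ∀ x y x' y' : V, G.Adj x y → G.Adj x' y' → ∃ φ : G ≃g G, φ x = x' ∧ φ y = y'

/-- Half-arc-transitive graphs: vertex- and edge-transitive, but not arc-transitive. -/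
def IsHalfArcTransitive {V : Type*} (G : SimpleGraph V) : Prop :=
  IsVertexTransitive G ∧ IsEdgeTransitive G ∧ ¬ IsArcTransitive G

/-- Every vertex has exactly `d` neighbours. -/
def HasValence {V : Type*} (G : SimpleGraph V) (d : ℕ) : Prop :=
  ∀ x : V, (G.neighborSet x).ncard = d

/-- `D` (where `D x y` means `x → y`) is an orbit of the automorphism group of `G` on the arcs
of `G`. If `G` is half-arc-transitive, there are exactly two such orbits, and they are the two
paired orientations of the edges of `G` that are induced by the automorphism group. -/
def IsInducedOrientation {V : Type*} (G : SimpleGraph V) (D : V → V → Prop) : Prop :=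
  ∃ x₀ y₀ : V, G.Adj x₀ y₀ ∧ ∀ x y : V, D x y ↔ ∃ φ : G ≃g G, φ x₀ = x ∧ φ y₀ = y

/-- `x 0, x 1, …, x (n + 1)` is an alternating walk, with `n + 1 ≥ 1` edges, for the orientation
`D`: any two consecutive edges are traversed in opposite directions. The first edge may be
traversed in either direction. -/
def IsAlternatingWalk {V : Type*} (D : V → V → Prop) (n : ℕ) (x : ℕ → V) : Prop :=
  (∀ i ≤ n, if Even i then D (x i) (x (i + 1)) else D (x (i + 1)) (x i)) ∨
  (∀ i ≤ n, if Even i then D (x (i + 1)) (x i) else D (x i) (x (i + 1)))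

/-- The reachability relation on the edges of `G`: some alternating walk has starting edge `e`
and terminal edge `f`. -/
def Reachable {V : Type*} (G : SimpleGraph V) (D : V → V → Prop) (e f : G.edgeSet) : Prop :=
  ∃ (n : ℕ) (x : ℕ → V), IsAlternatingWalk D n x ∧
    (e : Sym2 V) = s(x 0, x 1) ∧ (f : Sym2 V) = s(x n, x (n + 1))

/-- The alternets: the equivalence classes of the reachability relation. -/
def alternets {V : Type*} (G : SimpleGraph V) (D : V → V → Prop) : Set (Set G.edgeSet) :=
  Set.range fun e : G.edgeSet => {f : G.edgeSet | Reachable G D e f}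

/-- The reachability relation is universal: any edge is reachable from any edge. -/
def IsReachabilityUniversal {V : Type*} (G : SimpleGraph V) (D : V → V → Prop) : Prop :=
  ∀ e f : G.edgeSet, Reachable G D e f

end Symmetry

/-- The conditions on the parameters `b₀`, `b`, `m` of the family. -/
structure IsAdmissible (b₀ b m : ℕ) : Prop where
  one_lt : 1 < b₀
  b_eq : (b : ℤ) = 4 * (b₀ : ℤ) - 1
  two_lt : 2 < m
  even : Even m
  dvd : m ∣ b ^ 2 + 3
  mod_four : m ≡ 2 [MOD 4]
  b_lt : b < 2 * m

/-- The graph `N(2m; 1, b, b + m + 1; m - 1)`. -/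
def familyGraph (b m : ℕ) : SimpleGraph (ZMod (2 * m) ⊕ ZMod (2 * m)) :=
  nestGraph (2 * m) 1 (b : ZMod (2 * m)) ((b : ZMod (2 * m)) + (m : ZMod (2 * m)) + 1)
    ((m : ZMod (2 * m)) - 1)

/-! Write m = 2k with k odd, and put w = (b - 1)/2 modulo k. Then 4(w² + w + 1) = b² + 3 = 0, so w²
+ w + 1 = 0, and 1 + w behaves like a sixth root of unity. By the Chinese remainder theorem the Nest
graph becomes a Cayley graph of Q₈ × ℤ/k (`exists_iso_hexGraph`). Its six generators ("letters")
project to the powers of 1 + w in ℤ/k, the corners of a hexagon, and to ±i, ±j, ±k in Q₈. The three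
even letters define the orientation `hexArc`.

Left translations, together with a rotation of order three, are transitive on these arcs. The main
point is that every automorphism preserves the orientation (`hexArc_map`). Counting walks of length
three recovers which letters are neighbours on the hexagon, hence which are opposite, so
automorphisms send straight lines to straight lines. Since Q₈ has exponent 4, 4(1 + w) steps along
one letter end where 4 steps along the next letter do; this fixes the sense of rotation. Finally,
consecutive letters i, i + 1 span a triangle exactly when i is odd, so parity is preserved. No
automorphism can then reverse an edge.

For reachability only the tails of arcs matter: two tails are linked when they have a common head.
Such links move by products of an even letter and the inverse of another, and they connect all
vertices whose ℤ/k-components differ by a multiple of 1 - w (`reflTransGen_of_eq`). Because (1 -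
w)(2 + w) = 3, this is everything if 3 ∤ k. If 3 ∣ k, then w is 1 modulo 3 and every arc adds 1 to
the residue modulo 3, which leaves exactly three classes. -/

/-! ### Alternating walks and automorphism-invariant orientations -/

/-- An orientation `D` of the edges of `G` that is preserved by every automorphism of `G` and on
whose arcs the automorphism group is transitive. Every vertex is the tail of an arc. -/
structure IsCanonicalOrientation {V : Type*} (G : SimpleGraph V) (D : V → V → Prop) : Prop where
  adj_iff : ∀ x y, G.Adj x y ↔ D x y ∨ D y x
  asymm : ∀ x y, D x y → ¬ D y x
  map : ∀ (φ : G ≃g G) x y, D x y → D (φ x) (φ y)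
  trans : ∀ x y x' y', D x y → D x' y' → ∃ φ : G ≃g G, φ x = x' ∧ φ y = y'
  out : ∀ x, ∃ y, D x y

/-- Two vertices with a common out-neighbour. -/
def SharesHead {V : Type*} (D : V → V → Prop) (x y : V) : Prop := ∃ z, D x z ∧ D y z

theorem isAlternatingWalk_flip {V : Type*} (D : V → V → Prop) (n : ℕ) (x : ℕ → V) :
    IsAlternatingWalk (fun a b => D b a) n x ↔ IsAlternatingWalk D n x := by
  unfold IsAlternatingWalk
  exact or_comm

theorem reachable_flip {V : Type*} (G : SimpleGraph V) (D : V → V → Prop) :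
    Reachable G (fun a b => D b a) = Reachable G D := by
  funext e f
  simp only [Reachable, isAlternatingWalk_flip]

theorem sharesHead_symm {V : Type*} {D : V → V → Prop} {x y : V} (h : SharesHead D x y) :
    SharesHead D y x := by
  obtain ⟨z, h1, h2⟩ := h
  exact ⟨z, h2, h1⟩

theorem reflTransGen_sharesHead_symm {V : Type*} {D : V → V → Prop} {x y : V}
    (h : Relation.ReflTransGen (SharesHead D) x y) :
    Relation.ReflTransGen (SharesHead D) y x :=
  haveI : Std.Symm (SharesHead D) := ⟨fun _ _ => sharesHead_symm⟩
  Std.Symm.symm _ _ h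

/-- The walk always starts against its first arc, so each link of tails prepends two edges and
leaves the parity of the later indices unchanged. -/
theorem exists_walk_of_tails {V : Type*} {D : V → V → Prop} {x x' : V}
    (h : Relation.ReflTransGen (SharesHead D) x x') :
    ∀ y y', D x y → D x' y' → ∃ (n : ℕ) (w : ℕ → V),
      (∀ i ≤ n, if Even i then D (w (i + 1)) (w i) else D (w i) (w (i + 1))) ∧
      w 0 = y ∧ w 1 = x ∧ w n = y' ∧ w (n + 1) = x' := by
  induction h using Relation.ReflTransGen.head_induction_on with
  | refl =>
    intro y y' h1 h2
    refine ⟨2, fun i => match i with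
      | 0 => y
      | 1 => x'
      | 2 => y'
      | _ => x', ?_, rfl, rfl, rfl, rfl⟩
    intro i hi
    interval_cases i <;> simp [h1, h2]
  | @head a c hac _ ih =>
    intro y y' h1 h2
    obtain ⟨z, hz1, hz2⟩ := hac
    obtain ⟨n, w, hw, w0, w1, w2, w3⟩ := ih z y' hz2 h2
    refine ⟨n + 2, fun i => match i with
      | 0 => y
      | 1 => a
      | (j + 2) => w j, ?_, rfl, rfl, w2, w3⟩
    intro i hi
    match i with
    | 0 => simpa using h1
    | 1 => simpa [w0] using hz1
    | (j + 2) =>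
      have := hw j (by omega)
      simpa [Nat.even_add] using this

/-- Consecutive edges of an alternating walk meet either in a common tail, which changes nothing, or
in a common head, which is one `SharesHead` link. -/
theorem tails_of_walk {V : Type*} {D : V → V → Prop} {n : ℕ} {w : ℕ → V}
    (h : ∀ i ≤ n, if Even i then D (w i) (w (i + 1)) else D (w (i + 1)) (w i)) :
    ∀ i ≤ n, Relation.ReflTransGen (SharesHead D) (w 0) (if Even i then w i else w (i + 1)) := by
  intro i
  induction i with
  | zero => intro _; simp; exact Relation.ReflTransGen.refl
  | succ k ih =>
    intro hk
    have h1 := ih (by omega)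
    have h2 := h k (by omega)
    have h3 := h (k + 1) hk
    by_cases he : Even k
    · have ho : ¬ Even (k + 1) := by simpa [Nat.even_add_one] using he
      simp only [he, ho, if_true, if_false] at *
      exact h1.tail ⟨_, h2, h3⟩
    · have ho : Even (k + 1) := by simpa [Nat.even_add_one] using he
      simp only [he, ho, if_true, if_false] at *
      exact h1

theorem tails_of_walk' {V : Type*} {D : V → V → Prop} {n : ℕ} {w : ℕ → V}
    (h : ∀ i ≤ n, if Even i then D (w (i + 1)) (w i) else D (w i) (w (i + 1))) :
    ∀ i ≤ n, Relation.ReflTransGen (SharesHead D) (w 1) (if Even i then w (i + 1) else w i) := by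
  intro i
  induction i with
  | zero => intro _; simp; exact Relation.ReflTransGen.refl
  | succ k ih =>
    intro hk
    have h1 := ih (by omega)
    have h2 := h k (by omega)
    have h3 := h (k + 1) hk
    by_cases he : Even k
    · have ho : ¬ Even (k + 1) := by simpa [Nat.even_add_one] using he
      simp only [he, ho, if_true, if_false] at *
      exact h1
    · have ho : Even (k + 1) := by simpa [Nat.even_add_one] using he
      simp only [he, ho, if_true, if_false] at *
      exact h1.tail ⟨_, h2, h3⟩

namespace IsCanonicalOrientation

variable {V : Type*} {G : SimpleGraph V} {D : V → V → Prop}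

theorem tail_eq (h : IsCanonicalOrientation G D) {x y a c : V} (h1 : D x y) (h2 : D a c)
    (he : s(x, y) = s(a, c)) : x = a := by
  rcases Sym2.eq_iff.1 he with ⟨h3, _⟩ | ⟨h3, h4⟩
  · exact h3
  · subst h3 h4
    exact absurd h1 (h.asymm _ _ h2)

/-- Reduces walks of edges to a relation on vertices. Asymmetry of `D` makes the tail of an edge
well defined, and all arcs with the same tail are mutually reachable. -/
theorem reachable_iff (h : IsCanonicalOrientation G D) {e f : G.edgeSet} {x y x' y' : V}
    (h1 : D x y) (h2 : D x' y') (he : (e : Sym2 V) = s(x, y)) (hf : (f : Sym2 V) = s(x', y')) :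
    Reachable G D e f ↔ Relation.ReflTransGen (SharesHead D) x x' := by
  constructor
  · rintro ⟨n, w, hw | hw, h3, h4⟩
    · have h0 := hw 0 (by omega)
      have hn := hw n le_rfl
      have ht := tails_of_walk hw n le_rfl
      simp only [Even.zero, if_true, zero_add] at h0
      have e0 : w 0 = x := h.tail_eq h0 h1 (by rw [← h3, he])
      by_cases hev : Even n
      · simp only [hev, if_true] at hn ht
        have e1 : w n = x' := h.tail_eq hn h2 (by rw [← h4, hf])
        rwa [e0, e1] at ht
      · simp only [hev, if_false] at hn ht
        have e1 : w (n + 1) = x' := h.tail_eq hn h2 (by rw [Sym2.eq_swap, ← h4, hf])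
        rwa [e0, e1] at ht
    · have h0 := hw 0 (by omega)
      have hn := hw n le_rfl
      have ht := tails_of_walk' hw n le_rfl
      simp only [Even.zero, if_true, zero_add] at h0
      have e0 : w 1 = x := h.tail_eq h0 h1 (by rw [Sym2.eq_swap, ← h3, he])
      by_cases hev : Even n
      · simp only [hev, if_true] at hn ht
        have e1 : w (n + 1) = x' := h.tail_eq hn h2 (by rw [Sym2.eq_swap, ← h4, hf])
        rwa [e0, e1] at ht
      · simp only [hev, if_false] at hn ht
        have e1 : w n = x' := h.tail_eq hn h2 (by rw [← h4, hf])
        rwa [e0, e1] at ht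
  · intro ht
    obtain ⟨n, w, hw, w0, w1, w2, w3⟩ := exists_walk_of_tails ht y y' h1 h2
    refine ⟨n, w, Or.inr hw, ?_, ?_⟩
    · rw [he, w0, w1, Sym2.eq_swap]
    · rw [hf, w2, w3, Sym2.eq_swap]

theorem exists_arc (h : IsCanonicalOrientation G D) (e : G.edgeSet) :
    ∃ x y, D x y ∧ (e : Sym2 V) = s(x, y) := by
  obtain ⟨e, he⟩ := e
  induction e with
  | h x y =>
    rcases (h.adj_iff x y).1 he with h1 | h1
    · exact ⟨x, y, h1, rfl⟩
    · exact ⟨y, x, h1, Sym2.eq_swap⟩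

theorem equivalence_reachable (h : IsCanonicalOrientation G D) :
    Equivalence (Reachable G D) := by
  choose t hd ht hd' using h.exists_arc
  have key : ∀ e f, Reachable G D e f ↔ Relation.ReflTransGen (SharesHead D) (t e) (t f) :=
    fun e f => h.reachable_iff (ht e) (ht f) (hd' e) (hd' f)
  refine ⟨fun e => (key e e).2 .refl, fun {e f} hr => ?_, fun {e f g} h1 h2 => ?_⟩
  · rw [key] at hr ⊢
    exact reflTransGen_sharesHead_symm hr
  · rw [key] at h1 h2 ⊢
    exact h1.trans h2

theorem edge_mem (h : IsCanonicalOrientation G D) {x y : V} (hd : D x y) : s(x, y) ∈ G.edgeSet :=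
  (h.adj_iff x y).2 (Or.inl hd)

theorem universal_iff (h : IsCanonicalOrientation G D) :
    IsReachabilityUniversal G D ↔ ∀ x y, Relation.ReflTransGen (SharesHead D) x y := by
  constructor
  · intro hu x y
    obtain ⟨x', hx⟩ := h.out x
    obtain ⟨y', hy⟩ := h.out y
    exact (h.reachable_iff hx hy rfl rfl).1 (hu ⟨_, h.edge_mem hx⟩ ⟨_, h.edge_mem hy⟩)
  · intro ht e f
    obtain ⟨x, x', hx, he⟩ := h.exists_arc e
    obtain ⟨y, y', hy, hf⟩ := h.exists_arc f
    exact (h.reachable_iff hx hy he hf).2 (ht x y)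

theorem ncard_alternets (h : IsCanonicalOrientation G D) {ι : Type*} (c : V → ι)
    (hc : Function.Surjective c)
    (ht : ∀ x y, Relation.ReflTransGen (SharesHead D) x y ↔ c x = c y) :
    (alternets G D).ncard = Nat.card ι := by
  choose t hd htd hd' using h.exists_arc
  have key : ∀ e f, Reachable G D e f ↔ c (t e) = c (t f) :=
    fun e f => (h.reachable_iff (htd e) (htd f) (hd' e) (hd' f)).trans (ht _ _)
  have hsurj : ∀ i, ∃ e, c (t e) = i := by
    intro i
    obtain ⟨x, rfl⟩ := hc i
    obtain ⟨y, hy⟩ := h.out x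
    exact ⟨⟨_, h.edge_mem hy⟩, congrArg c (h.tail_eq (htd _) hy (hd' _).symm)⟩
  have himg : alternets G D = Set.range fun i : ι => {f : G.edgeSet | i = c (t f)} := by
    ext A
    constructor
    · rintro ⟨e, rfl⟩
      exact ⟨c (t e), by simp only [key]⟩
    · rintro ⟨i, rfl⟩
      obtain ⟨e, rfl⟩ := hsurj i
      exact ⟨e, by simp only [key]⟩
  rw [himg]
  apply Set.ncard_range_of_injective
  intro i j hij
  obtain ⟨e, rfl⟩ := hsurj i
  have : e ∈ {f : G.edgeSet | c (t e) = c (t f)} := rfl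
  simp only at hij
  rw [hij] at this
  exact this.symm

theorem isHalfArcTransitive (h : IsCanonicalOrientation G D) [Nonempty V] :
    IsHalfArcTransitive G := by
  refine ⟨fun x y => ?_, fun e he f hf => ?_, fun ha => ?_⟩
  · obtain ⟨x', hx⟩ := h.out x
    obtain ⟨y', hy⟩ := h.out y
    obtain ⟨φ, hφ, _⟩ := h.trans _ _ _ _ hx hy
    exact ⟨φ, hφ⟩
  · obtain ⟨x, x', hx, he'⟩ := h.exists_arc ⟨e, he⟩
    obtain ⟨y, y', hy, hf'⟩ := h.exists_arc ⟨f, hf⟩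
    obtain ⟨φ, h1, h2⟩ := h.trans _ _ _ _ hx hy
    refine ⟨φ, ?_⟩
    simp only at he' hf'
    rw [he', hf', Sym2.map_mk, h1, h2]
  · obtain ⟨x⟩ := ‹Nonempty V›
    obtain ⟨y, hy⟩ := h.out x
    have hadj := (h.adj_iff x y).2 (Or.inl hy)
    obtain ⟨φ, h1, h2⟩ := ha x y y x hadj hadj.symm
    have := h.map φ _ _ hy
    rw [h1, h2] at this
    exact h.asymm _ _ hy this

/-- The orbit of an arc depends only on whether that arc agrees with `D`; since alternating walks
are unaffected by reversal, all claims may be checked on `D` alone. -/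
theorem eq_or_eq_flip (h : IsCanonicalOrientation G D) {D' : V → V → Prop}
    (hD : IsInducedOrientation G D') : D' = D ∨ D' = fun x y => D y x := by
  obtain ⟨x₀, y₀, hadj, hiff⟩ := hD
  rcases (h.adj_iff x₀ y₀).1 hadj with h0 | h0
  · left
    funext x y
    rw [eq_iff_iff, hiff]
    constructor
    · rintro ⟨φ, rfl, rfl⟩
      exact h.map φ _ _ h0
    · exact h.trans _ _ _ _ h0
  · right
    funext x y
    rw [eq_iff_iff, hiff]
    constructor
    · rintro ⟨φ, rfl, rfl⟩
      exact h.map φ _ _ h0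
    · intro h1
      obtain ⟨φ, h2, h3⟩ := h.trans _ _ _ _ h0 h1
      exact ⟨φ, h3, h2⟩

theorem reachable_eq (h : IsCanonicalOrientation G D) {D' : V → V → Prop}
    (hD : IsInducedOrientation G D') : Reachable G D' = Reachable G D := by
  rcases h.eq_or_eq_flip hD with rfl | rfl
  · rfl
  · exact reachable_flip G D

theorem comap {W : Type*} {H : SimpleGraph W} (h : IsCanonicalOrientation G D) (e : H ≃g G) :
    IsCanonicalOrientation H (fun x y => D (e x) (e y)) where
  adj_iff x y := by rw [← h.adj_iff, e.map_adj_iff]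
  asymm x y := h.asymm _ _
  map φ x y hd := by
    simpa using h.map ((e.symm.trans φ).trans e) _ _ hd
  trans x y x' y' h1 h2 := by
    obtain ⟨φ, h3, h4⟩ := h.trans _ _ _ _ h1 h2
    exact ⟨(e.trans φ).trans e.symm, by simp [h3], by simp [h4]⟩
  out x := by
    obtain ⟨y, hy⟩ := h.out (e x)
    exact ⟨e.symm y, by simpa using hy⟩

end IsCanonicalOrientation

theorem reflTransGen_sharesHead_comap {V W : Type*} (D : V → V → Prop) (e : W ≃ V) (x y : W) :
    Relation.ReflTransGen (SharesHead fun x y => D (e x) (e y)) x y ↔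
      Relation.ReflTransGen (SharesHead D) (e x) (e y) := by
  constructor
  · intro h
    refine Relation.ReflTransGen.lift e ?_ x y h
    rintro a c ⟨z, h1, h2⟩
    exact ⟨e z, h1, h2⟩
  · intro h
    have := Relation.ReflTransGen.lift (p := SharesHead fun x y => D (e x) (e y)) e.symm ?_ _ _ h
    · simpa [Function.onFun] using this
    · rintro a c ⟨z, h1, h2⟩
      exact ⟨e.symm z, by simpa using h1, by simpa using h2⟩

/-! ### The Cayley graph of Q₈ × ℤ/n with hexagonal generators -/

open QuaternionGroup in
/-- The components in `Q₈` of the six elements of the connection set, in cyclic order. -/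
def letterQuat : Fin 6 → QuaternionGroup 2 := ![a 1, xa 2, xa 1, a 3, xa 0, xa 3]

/-- The coefficients at `1` of the six units `(1 + w) ^ i` of `ℤ[w]`, where `w ^ 2 + w + 1 = 0`. -/
def letterRe : Fin 6 → ℤ := ![1, 1, 0, -1, -1, 0]

/-- The coefficients at `w` of the six units `(1 + w) ^ i` of `ℤ[w]`, where `w ^ 2 + w + 1 = 0`. -/
def letterIm : Fin 6 → ℤ := ![0, 1, 1, 0, -1, -1]

/-- The unit `(1 + w) ^ i`, for a primitive cube root of unity `w`. -/
def letterPos {n : ℕ} (w : ZMod n) (i : Fin 6) : ZMod n := letterRe i + letterIm i * w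

/-- Right multiplication by an element of the connection set in `Q₈ × ℤ/n`. -/
def step {n : ℕ} (w : ZMod n) (i : Fin 6) (x : QuaternionGroup 2 × ZMod n) :
    QuaternionGroup 2 × ZMod n :=
  (x.1 * letterQuat i, x.2 + letterPos w i)

/-- The canonical orientation of `hexGraph`. -/
def hexArc {n : ℕ} (w : ZMod n) (x y : QuaternionGroup 2 × ZMod n) : Prop :=
  ∃ i : Fin 6, i.val % 2 = 0 ∧ y = step w i x

theorem letterQuat_mul_add_three : ∀ i, letterQuat i * letterQuat (i + 3) = 1 := by decide

theorem letterPos_add_three {n : ℕ} (w : ZMod n) (i : Fin 6) :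
    letterPos w (i + 3) = -letterPos w i := by
  fin_cases i <;> simp [letterPos, letterRe, letterIm] <;> ring

theorem step_add_three {n : ℕ} (w : ZMod n) (i : Fin 6) (x : QuaternionGroup 2 × ZMod n) :
    step w (i + 3) (step w i x) = x := by
  ext1
  · simp only [step, mul_assoc, letterQuat_mul_add_three, mul_one]
  · simp only [step, letterPos_add_three, add_assoc, add_neg_cancel, add_zero]

/-- The Cayley graph of `Q₈ × ℤ/n` with respect to the six elements `(± i, ± 1)`, `(± j, ± w)`,
`(± k, ± w ^ 2)`. -/
def hexGraph {n : ℕ} (w : ZMod n) : SimpleGraph (QuaternionGroup 2 × ZMod n) where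
  Adj x y := ∃ i : Fin 6, y = step w i x
  symm := ⟨by
    rintro x y ⟨i, rfl⟩
    exact ⟨i + 3, (step_add_three w i x).symm⟩⟩
  loopless := ⟨by
    rintro x ⟨i, hi⟩
    have h1 : x.1 = x.1 * letterQuat i := congrArg Prod.fst hi
    have h2 : ∀ i, letterQuat i ≠ 1 := by decide
    exact h2 i (by simpa using h1)⟩

theorem hexGraph_adj {n : ℕ} (w : ZMod n) (x y : QuaternionGroup 2 × ZMod n) :
    (hexGraph w).Adj x y ↔ ∃ i : Fin 6, y = step w i x := Iff.rfl

theorem hexGraph_adj_step {n : ℕ} (w : ZMod n) (i : Fin 6) (x : QuaternionGroup 2 × ZMod n) :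
    (hexGraph w).Adj x (step w i x) := ⟨i, rfl⟩

/-- Multiply A + Bw by its conjugate A - B - Bw: the product is the Eisenstein norm. -/
theorem dvd_norm {n : ℕ} {w : ZMod n} (hw : w ^ 2 + w + 1 = 0) {A B : ℤ}
    (h : (A : ZMod n) + B * w = 0) : (n : ℤ) ∣ A ^ 2 - A * B + B ^ 2 := by
  rw [← ZMod.intCast_zmod_eq_zero_iff_dvd]
  push_cast
  linear_combination ((A : ZMod n) - B - B * w) * h + (B : ZMod n) ^ 2 * hw

theorem letterPos_injective {n : ℕ} {w : ZMod n} (hw : w ^ 2 + w + 1 = 0) (hn : Odd n)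
    (h3 : 3 < n) : Function.Injective (letterPos w) := by
  intro i j hij
  by_contra hne
  have h1 : ((letterRe i - letterRe j : ℤ) : ZMod n) + (letterIm i - letterIm j : ℤ) * w = 0 := by
    simp only [letterPos] at hij
    push_cast
    linear_combination hij
  have h2 := dvd_norm hw h1
  have h4 : ∀ i j : Fin 6, i ≠ j →
      ∀ N, N = (letterRe i - letterRe j) ^ 2
        - (letterRe i - letterRe j) * (letterIm i - letterIm j) + (letterIm i - letterIm j) ^ 2 →
      N = 1 ∨ N = 3 ∨ N = 4 := by
    simp only [forall_eq]
    decide +kernel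
  have h5 := h4 i j hne _ rfl
  generalize (letterRe i - letterRe j) ^ 2
        - (letterRe i - letterRe j) * (letterIm i - letterIm j) + (letterIm i - letterIm j) ^ 2
    = N at h2 h5
  have h6 := Int.le_of_dvd (by omega) h2
  obtain ⟨k, hk⟩ := hn
  -- Differences of distinct sixth roots of unity have norm 1, 3 or 4, so n > 3 leaves only n = 4,
  -- which is even.
  have h7 : (n : ℤ) = 4 := by omega
  omega

/-! ### Recognising angles by counting walks of length three -/

/-- The two elements of the connection set with indices `s`, `t` are at an angle of 60 degrees. -/
def HexNear (s t : Fin 6) : Prop := t = s + 1 ∨ s = t + 1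

instance (s t : Fin 6) : Decidable (HexNear s t) := inferInstanceAs (Decidable (_ ∨ _))

/-- The number of walks of length three in `hexGraph` between the neighbours with indices `s`, `t`
of a vertex. -/
def walkCount (n w : ℤ) (s t : Fin 6) : ℕ :=
  (Finset.univ.filter fun p : Fin 6 × Fin 6 => ∃ l : Fin 6,
    ((letterRe s + letterRe p.1 + letterRe p.2 + letterRe l - letterRe t)
      + (letterIm s + letterIm p.1 + letterIm p.2 + letterIm l - letterIm t) * w) % n = 0 ∧
    letterQuat s * letterQuat p.1 * letterQuat p.2 * letterQuat l = letterQuat t).card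

theorem four_le_walkCount_of_small : ∀ n ∈ Finset.range 32, ∀ w ∈ Finset.range n,
    (n % 2 = 1 ∧ 3 < n ∧ (w * w + w + 1) % n = 0) → ∀ s t : Fin 6, s ≠ t →
    (4 ≤ walkCount (n : ℕ) (w : ℕ) s t ↔ HexNear s t) := by
  decide +kernel

/-- A sum of five unit vectors has length at most 5. -/
theorem norm_le : ∀ s i j l t : Fin 6,
    (letterRe s + letterRe i + letterRe j + letterRe l - letterRe t) ^ 2
    - (letterRe s + letterRe i + letterRe j + letterRe l - letterRe t) *
      (letterIm s + letterIm i + letterIm j + letterIm l - letterIm t)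
    + (letterIm s + letterIm i + letterIm j + letterIm l - letterIm t) ^ 2 ≤ 25 := by
  decide +kernel

/-- Beyond 25 a relation between five letters modulo n must already hold in ℤ[w], so the walk counts
no longer depend on n. -/
theorem eq_zero_of_norm {n : ℕ} {w : ZMod n} (hw : w ^ 2 + w + 1 = 0) (hn : 25 < n) {A B : ℤ}
    (h : (A : ZMod n) + B * w = 0) (hN : A ^ 2 - A * B + B ^ 2 ≤ 25) : A = 0 ∧ B = 0 := by
  have h1 := dvd_norm hw h
  have h2 : A ^ 2 - A * B + B ^ 2 = 0 := by
    by_contra h0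
    have h3 : 0 < A ^ 2 - A * B + B ^ 2 :=
      lt_of_le_of_ne (by nlinarith [sq_nonneg (A - B), sq_nonneg (A + B)]) (Ne.symm h0)
    have := Int.le_of_dvd h3 h1
    omega
  have hA : A ^ 2 = 0 := by nlinarith [sq_nonneg (A - B), sq_nonneg A, sq_nonneg B]
  have hB : B ^ 2 = 0 := by nlinarith [sq_nonneg (A - B), sq_nonneg A, sq_nonneg B]
  exact ⟨by simpa using hA, by simpa using hB⟩

theorem emod_eq_zero_iff {n : ℕ} [NeZero n] (w : ZMod n) (A B : ℤ) :
    (A + B * (w.val : ℤ)) % (n : ℤ) = 0 ↔ (A : ZMod n) + B * w = 0 := by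
  rw [← Int.dvd_iff_emod_eq_zero, ← ZMod.intCast_zmod_eq_zero_iff_dvd]
  push_cast
  rw [ZMod.natCast_val, ZMod.cast_id]

theorem four_le_walkCount {n : ℕ} [NeZero n] {w : ZMod n} (hw : w ^ 2 + w + 1 = 0) (hn : Odd n)
    (h3 : 3 < n) (s t : Fin 6) (hst : s ≠ t) :
    4 ≤ walkCount n w.val s t ↔ HexNear s t := by
  by_cases hlt : n < 32
  · refine four_le_walkCount_of_small n (Finset.mem_range.2 hlt) w.val
      (Finset.mem_range.2 w.val_lt) ⟨Nat.odd_iff.1 hn, h3, ?_⟩ s t hst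
    rw [← Nat.dvd_iff_mod_eq_zero, ← ZMod.natCast_eq_zero_iff]
    push_cast
    rw [ZMod.natCast_val, ZMod.cast_id]
    linear_combination hw
  -- The pair n = 31, w = 5 serves as a model for all larger n: 31 exceeds the norm bound 25 and
  -- lies in the range checked by enumeration.
  · have h31 : ((5 : ZMod 31)) ^ 2 + 5 + 1 = 0 := by decide
    have key : walkCount n w.val s t = walkCount (31 : ℕ) ((5 : ZMod 31).val : ℕ) s t := by
      unfold walkCount
      congr 1
      refine Finset.filter_congr fun p _ => exists_congr fun l => and_congr_left fun _ => ?_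
      rw [emod_eq_zero_iff, emod_eq_zero_iff]
      have hN := norm_le s p.1 p.2 l t
      constructor <;> intro h
      · obtain ⟨hA, hB⟩ := eq_zero_of_norm hw (by omega) h hN
        simp [hA, hB]
      · obtain ⟨hA, hB⟩ := eq_zero_of_norm h31 (by omega) h hN
        simp [hA, hB]
    rw [key]
    exact four_le_walkCount_of_small 31 (by decide) 5 (by decide) (by decide) s t hst

/-- Two neighbours `x`, `y` of `g` that are joined by at least four walks of length three. -/
def NearAt {V : Type*} (G : SimpleGraph V) (g x y : V) : Prop :=
  G.Adj g x ∧ G.Adj g y ∧ x ≠ y ∧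
    4 ≤ {p : V × V | G.Adj x p.1 ∧ G.Adj p.1 p.2 ∧ G.Adj p.2 y}.ncard

/-- Two neighbours `x`, `y` of `g` that are not related by `NearAt G g` and have no common
relative. -/
def OppositeAt {V : Type*} (G : SimpleGraph V) (g x y : V) : Prop :=
  G.Adj g x ∧ G.Adj g y ∧ x ≠ y ∧ ¬ NearAt G g x y ∧ ∀ z, ¬ (NearAt G g x z ∧ NearAt G g z y)

theorem nearAt_map {V : Type*} {G : SimpleGraph V} (φ : G ≃g G) (g x y : V) :
    NearAt G (φ g) (φ x) (φ y) ↔ NearAt G g x y := by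
  have key : {p : V × V | G.Adj (φ x) p.1 ∧ G.Adj p.1 p.2 ∧ G.Adj p.2 (φ y)} =
      Prod.map φ φ '' {p : V × V | G.Adj x p.1 ∧ G.Adj p.1 p.2 ∧ G.Adj p.2 y} := by
    ext ⟨c, d⟩
    constructor
    · intro h
      refine ⟨(φ.symm c, φ.symm d), ?_, by simp⟩
      obtain ⟨h1, h2, h3⟩ := h
      refine ⟨φ.map_adj_iff.1 ?_, φ.map_adj_iff.1 ?_, φ.map_adj_iff.1 ?_⟩
      · simpa using h1
      · simpa using h2
      · simpa using h3
    · rintro ⟨⟨c', d'⟩, h, he⟩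
      simp only [Prod.map_apply, Prod.mk.injEq] at he
      obtain ⟨rfl, rfl⟩ := he
      simpa only [Set.mem_ofPred_eq, φ.map_adj_iff] using h
  unfold NearAt
  rw [key, Set.ncard_image_of_injective _ (φ.injective.prodMap φ.injective), φ.map_adj_iff,
    φ.map_adj_iff, φ.injective.ne_iff]

theorem oppositeAt_map {V : Type*} {G : SimpleGraph V} (φ : G ≃g G) (g x y : V) :
    OppositeAt G (φ g) (φ x) (φ y) ↔ OppositeAt G g x y := by
  unfold OppositeAt
  rw [φ.map_adj_iff, φ.map_adj_iff, φ.injective.ne_iff, nearAt_map, φ.surjective.forall]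
  simp only [nearAt_map]

section hexGraph

variable {n : ℕ} {w : ZMod n}

theorem step_injective (hw : w ^ 2 + w + 1 = 0) (hn : Odd n) (h3 : 3 < n)
    (x : QuaternionGroup 2 × ZMod n) : Function.Injective fun i => step w i x := by
  intro i j hij
  have := congrArg Prod.snd hij
  exact letterPos_injective hw hn h3 (by simpa [step] using this)

theorem step_inj (hw : w ^ 2 + w + 1 = 0) (hn : Odd n) (h3 : 3 < n)
    {x : QuaternionGroup 2 × ZMod n} {i j : Fin 6} : step w i x = step w j x ↔ i = j :=
  (step_injective hw hn h3 x).eq_iff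

theorem add_three_add_three (i : Fin 6) : i + 3 + 3 = i := by
  revert i; decide

theorem ncard_neighborSet_hexGraph (hw : w ^ 2 + w + 1 = 0) (hn : Odd n) (h3 : 3 < n)
    (x : QuaternionGroup 2 × ZMod n) : ((hexGraph w).neighborSet x).ncard = 6 := by
  have : (hexGraph w).neighborSet x = Set.range fun i => step w i x := by
    ext y
    simp only [SimpleGraph.mem_neighborSet, hexGraph_adj, Set.mem_range, eq_comm]
  rw [this, Set.ncard_range_of_injective (step_injective hw hn h3 x), Nat.card_eq_fintype_card,
    Fintype.card_fin]

theorem step_step_step_step_eq_iff [NeZero n] (x : QuaternionGroup 2 × ZMod n)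
    (s i j l t : Fin 6) :
    step w l (step w j (step w i (step w s x))) = step w t x ↔
    ((letterRe s + letterRe i + letterRe j + letterRe l - letterRe t)
      + (letterIm s + letterIm i + letterIm j + letterIm l - letterIm t) * (w.val : ℤ))
        % (n : ℤ) = 0 ∧
    letterQuat s * letterQuat i * letterQuat j * letterQuat l = letterQuat t := by
  rw [emod_eq_zero_iff, Prod.ext_iff, and_comm]
  refine and_congr ?_ ?_
  · simp only [step, letterPos]
    push_cast
    constructor <;> intro h <;> linear_combination h
  · simp only [step, mul_assoc, mul_right_inj]

/-- Walks correspond to their first two letters, because distinct letters lead to distinct vertices;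
the third letter need only exist. -/
theorem nearAt_step [NeZero n] (hw : w ^ 2 + w + 1 = 0) (hn : Odd n) (h3 : 3 < n)
    (x : QuaternionGroup 2 × ZMod n) (s t : Fin 6) :
    NearAt (hexGraph w) x (step w s x) (step w t x) ↔ HexNear s t := by
  have hcount : {p : (QuaternionGroup 2 × ZMod n) × (QuaternionGroup 2 × ZMod n) |
      (hexGraph w).Adj (step w s x) p.1 ∧ (hexGraph w).Adj p.1 p.2 ∧
        (hexGraph w).Adj p.2 (step w t x)}.ncard = walkCount n w.val s t := by
    unfold walkCount
    rw [← Set.ncard_coe_finset]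
    let f : Fin 6 × Fin 6 → (QuaternionGroup 2 × ZMod n) × (QuaternionGroup 2 × ZMod n) :=
      fun p => (step w p.1 (step w s x), step w p.2 (step w p.1 (step w s x)))
    have hf : Function.Injective f := by
      rintro ⟨i, j⟩ ⟨i', j'⟩ h
      simp only [f, Prod.mk.injEq] at h
      obtain ⟨h1, h2⟩ := h
      rw [step_inj hw hn h3] at h1
      subst h1
      rw [step_inj hw hn h3] at h2
      rw [h2]
    rw [← Set.ncard_image_of_injective _ hf]
    congr 1
    ext ⟨y, z⟩
    simp only [Set.mem_ofPred_eq, Set.mem_image, Finset.coe_filter, Finset.mem_univ, true_and,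
      hexGraph_adj, Prod.exists, f, Prod.mk.injEq, ← step_step_step_step_eq_iff x]
    constructor
    · rintro ⟨⟨i, rfl⟩, ⟨j, rfl⟩, ⟨l, hl⟩⟩
      exact ⟨i, j, ⟨l, hl.symm⟩, rfl, rfl⟩
    · rintro ⟨i, j, ⟨l, hl⟩, rfl, rfl⟩
      exact ⟨⟨i, rfl⟩, ⟨j, rfl⟩, ⟨l, hl.symm⟩⟩
  have hne : HexNear s t → s ≠ t := by
    clear hcount
    revert s t
    decide
  unfold NearAt
  rw [hcount, Ne, step_inj hw hn h3]
  constructor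
  · rintro ⟨_, _, h1, h2⟩
    exact (four_le_walkCount hw hn h3 s t h1).1 h2
  · intro h
    exact ⟨hexGraph_adj_step w s x, hexGraph_adj_step w t x, hne h,
      (four_le_walkCount hw hn h3 s t (hne h)).2 h⟩

/-- On a 6-cycle, two distinct points that are neither adjacent nor have a common neighbour are
antipodal. -/
theorem oppositeAt_step [NeZero n] (hw : w ^ 2 + w + 1 = 0) (hn : Odd n) (h3 : 3 < n)
    (x : QuaternionGroup 2 × ZMod n) (s t : Fin 6) :
    OppositeAt (hexGraph w) x (step w s x) (step w t x) ↔ t = s + 3 := by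
  have key : ∀ s t : Fin 6, (s ≠ t ∧ ¬ HexNear s t ∧ ∀ r, ¬ (HexNear s r ∧ HexNear r t)) ↔
      t = s + 3 := by decide
  rw [← key]
  unfold OppositeAt
  rw [Ne, step_inj hw hn h3, nearAt_step hw hn h3]
  constructor
  · rintro ⟨_, _, h1, h2, h4⟩
    refine ⟨h1, h2, fun r hr => h4 (step w r x) ?_⟩
    rwa [nearAt_step hw hn h3, nearAt_step hw hn h3]
  · rintro ⟨h1, h2, h4⟩
    refine ⟨hexGraph_adj_step w s x, hexGraph_adj_step w t x, h1, h2, fun z hz => ?_⟩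
    obtain ⟨r, rfl⟩ := hz.1.2.1
    rw [nearAt_step hw hn h3, nearAt_step hw hn h3] at hz
    exact h4 r hz

/-! ### Automorphisms preserve straight lines, rotation sense and parity -/

/-- Seen from the middle vertex, the two ends of a straight path of length two are opposite, and
this relation is invariant under automorphisms. -/
theorem map_step_step [NeZero n] (hw : w ^ 2 + w + 1 = 0) (hn : Odd n) (h3 : 3 < n)
    (φ : hexGraph w ≃g hexGraph w) {x : QuaternionGroup 2 × ZMod n} {s t : Fin 6}
    (h : φ (step w s x) = step w t (φ x)) :
    φ (step w s (step w s x)) = step w t (step w t (φ x)) := by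
  have h1 : OppositeAt (hexGraph w) (step w s x) (step w (s + 3) (step w s x))
      (step w s (step w s x)) := by
    rw [oppositeAt_step hw hn h3, add_three_add_three]
  rw [← oppositeAt_map φ, step_add_three, h] at h1
  obtain ⟨r, hr⟩ := h1.2.1
  have h2 := oppositeAt_step hw hn h3 (step w t (φ x)) (t + 3) r
  rw [step_add_three, add_three_add_three, ← hr] at h2
  rw [hr, h2.1 h1]

theorem map_iterate_step [NeZero n] (hw : w ^ 2 + w + 1 = 0) (hn : Odd n) (h3 : 3 < n)
    (φ : hexGraph w ≃g hexGraph w) {x : QuaternionGroup 2 × ZMod n} {s t : Fin 6}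
    (h : φ (step w s x) = step w t (φ x)) (k : ℕ) :
    φ ((step w s)^[k] x) = (step w t)^[k] (φ x) := by
  have key : ∀ k, φ ((step w s)^[k] x) = (step w t)^[k] (φ x) ∧
      φ ((step w s)^[k + 1] x) = (step w t)^[k + 1] (φ x) := by
    intro k
    induction k with
    | zero => exact ⟨rfl, h⟩
    | succ k ih =>
      refine ⟨ih.2, ?_⟩
      have h1 : φ (step w s ((step w s)^[k] x)) = step w t (φ ((step w s)^[k] x)) := by
        rw [ih.1, ← Function.iterate_succ_apply' (step w s),
          ← Function.iterate_succ_apply' (step w t)]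
        exact ih.2
      have h2 := map_step_step hw hn h3 φ h1
      rw [ih.1] at h2
      simpa only [← Function.iterate_succ_apply' (step w s),
          ← Function.iterate_succ_apply' (step w t)] using h2
  exact (key k).1

theorem iterate_step (i : Fin 6) (x : QuaternionGroup 2 × ZMod n) (k : ℕ) :
    (step w i)^[k] x = (x.1 * letterQuat i ^ k, x.2 + k * letterPos w i) := by
  induction k with
  | zero => simp
  | succ k ih =>
    rw [Function.iterate_succ_apply', ih]
    ext1
    · simp only [step, pow_succ, mul_assoc]
    · simp only [step]; push_cast; ring

theorem iterate_step_four_mul (i : Fin 6) (x : QuaternionGroup 2 × ZMod n) (k : ℕ) :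
    (step w i)^[4 * k] x = (x.1, x.2 + 4 * k * letterPos w i) := by
  have h4 : ∀ i, letterQuat i ^ 4 = 1 := by decide
  rw [iterate_step, pow_mul, h4, one_pow, mul_one]
  push_cast
  rfl

theorem letterPos_add_one (hw : w ^ 2 + w + 1 = 0) (i : Fin 6) :
    letterPos w (i + 1) = (1 + w) * letterPos w i := by
  fin_cases i <;> simp [letterPos, letterRe, letterIm] <;>
    first | ring1 | linear_combination hw | linear_combination -hw

theorem letterPos_add_two (hw : w ^ 2 + w + 1 = 0) (i : Fin 6) :
    letterPos w (i + 2) = w * letterPos w i := by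
  have : i + 2 = i + 1 + 1 := by revert i; decide
  rw [this, letterPos_add_one hw, letterPos_add_one hw]
  linear_combination letterPos w i * hw

theorem isUnit_four (hn : Odd n) : IsUnit (4 : ZMod n) := by
  have : IsUnit ((4 : ℕ) : ZMod n) := by
    rw [ZMod.isUnit_iff_coprime]
    exact Nat.Coprime.pow_left 2 (Nat.coprime_two_left.2 hn)
  simpa using this

/-- Excludes reflections of the hexagon: multiplication by 1 + w takes each letter to the next one,
and it can be read off from where two straight lines meet. -/
theorem letter_map_add_one [NeZero n] (hw : w ^ 2 + w + 1 = 0) (hn : Odd n) (h3 : 3 < n)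
    (φ : hexGraph w ≃g hexGraph w) {x : QuaternionGroup 2 × ZMod n} {i s t : Fin 6}
    (h1 : φ (step w i x) = step w s (φ x)) (h2 : φ (step w (i + 1) x) = step w t (φ x)) :
    t = s + 1 := by
  have hc : (((1 + w).val : ℕ) : ZMod n) = 1 + w := by rw [ZMod.natCast_val, ZMod.cast_id]
  -- Multiples of 4 kill the Q₈-component; the factor 4 is cancelled at the end because n is odd.
  have h4 : (step w i)^[4 * (1 + w).val] x = (step w (i + 1))^[4 * 1] x := by
    rw [iterate_step_four_mul, iterate_step_four_mul, letterPos_add_one hw, hc]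
    push_cast
    ring_nf
  have h5 := congrArg φ h4
  rw [map_iterate_step hw hn h3 φ h1, map_iterate_step hw hn h3 φ h2, iterate_step_four_mul,
    iterate_step_four_mul, hc] at h5
  have h6 := congrArg Prod.snd h5
  apply letterPos_injective hw hn h3
  apply (isUnit_four hn).mul_left_cancel
  rw [letterPos_add_one hw]
  push_cast at h6
  linear_combination -h6

/-- The ℤ/n-component forces the third side of the triangle to be letter i + 2; only the
Q₈-component then decides whether it closes up. -/
theorem adj_step_step_add_one (hw : w ^ 2 + w + 1 = 0) (hn : Odd n) (h3 : 3 < n)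
    (x : QuaternionGroup 2 × ZMod n) (i : Fin 6) :
    (hexGraph w).Adj (step w i x) (step w (i + 1) x) ↔ i.val % 2 = 1 := by
  have hq : ∀ i, letterQuat i * letterQuat (i + 2) = letterQuat (i + 1) ↔ i.val % 2 = 1 := by
    decide
  have hp : letterPos w i + letterPos w (i + 2) = letterPos w (i + 1) := by
    rw [letterPos_add_one hw, letterPos_add_two hw]
    ring
  rw [hexGraph_adj, ← hq]
  constructor
  · rintro ⟨j, hj⟩
    have h1 := congrArg Prod.snd hj
    have h2 := congrArg Prod.fst hj
    simp only [step, mul_assoc, mul_right_inj] at h1 h2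
    have h4 : j = i + 2 := by
      apply letterPos_injective hw hn h3
      linear_combination -h1 - hp
    rw [← h4, h2]
  · intro h
    refine ⟨i + 2, ?_⟩
    ext1
    · simp only [step, mul_assoc, h]
    · simp only [step, add_assoc, hp]

theorem hexArc_map [NeZero n] (hw : w ^ 2 + w + 1 = 0) (hn : Odd n) (h3 : 3 < n)
    (φ : hexGraph w ≃g hexGraph w) (x y : QuaternionGroup 2 × ZMod n) (h : hexArc w x y) :
    hexArc w (φ x) (φ y) := by
  obtain ⟨i, hi, rfl⟩ := h
  have hex : ∀ j, ∃ s, φ (step w j x) = step w s (φ x) := fun j =>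
    (hexGraph_adj w _ _).1 (φ.map_adj_iff.2 (hexGraph_adj_step w j x))
  obtain ⟨s, hs⟩ := hex i
  obtain ⟨t, ht⟩ := hex (i + 1)
  have hst := letter_map_add_one hw hn h3 φ hs ht
  subst hst
  have h1 := adj_step_step_add_one hw hn h3 x i
  rw [← φ.map_adj_iff, hs, ht, adj_step_step_add_one hw hn h3] at h1
  exact ⟨s, by omega, hs⟩

/-! ### Translations, the rotation of order three, and arc orbits -/

/-- A permutation of the vertices that permutes the elements of the connection set is an
automorphism. -/
def hexIso (f : (QuaternionGroup 2 × ZMod n) ≃ (QuaternionGroup 2 × ZMod n)) (c : Fin 6)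
    (h : ∀ i x, f (step w i x) = step w (i + c) (f x)) : hexGraph w ≃g hexGraph w where
  toEquiv := f
  map_rel_iff' := by
    intro x y
    simp only [hexGraph_adj]
    constructor
    · rintro ⟨j, hj⟩
      refine ⟨j - c, f.injective ?_⟩
      rw [h, sub_add_cancel, hj]
    · rintro ⟨i, rfl⟩
      exact ⟨i + c, h i x⟩

theorem exists_translation (q : QuaternionGroup 2 × ZMod n) :
    ∃ φ : hexGraph w ≃g hexGraph w, φ (1, 0) = q ∧
      ∀ i, φ (step w i (1, 0)) = step w i q := by
  refine ⟨hexIso (w := w) ((Equiv.mulLeft q.1).prodCongr (Equiv.addLeft q.2)) 0 ?_, ?_, ?_⟩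
  · intro i x
    ext1 <;> simp [step, mul_assoc, add_assoc]
  · ext1 <;> simp [hexIso]
  · intro i
    ext1 <;> simp [hexIso, step]

open QuaternionGroup in
/-- The automorphism of order three of `Q₈` that permutes the generators in `letterQuat`. -/
def quatRotation : QuaternionGroup 2 → QuaternionGroup 2
  | a i => xa 1 ^ i.val
  | xa i => a 1 * xa 1 ^ i.val

theorem quatRotation_mul : ∀ x y, quatRotation (x * y) = quatRotation x * quatRotation y := by
  decide +kernel

theorem quatRotation_pow_three : ∀ x, quatRotation (quatRotation (quatRotation x)) = x := by
  decide +kernel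

theorem quatRotation_letterQuat : ∀ i, quatRotation (letterQuat i) = letterQuat (i + 2) := by
  decide +kernel

theorem exists_rotation (hw : w ^ 2 + w + 1 = 0) :
    ∃ φ : hexGraph w ≃g hexGraph w, φ (1, 0) = (1, 0) ∧
      ∀ i, φ (step w i (1, 0)) = step w (i + 2) (1, 0) := by
  have hw3 : w * (w * w) = 1 := by linear_combination (w - 1) * hw
  let f : (QuaternionGroup 2 × ZMod n) ≃ (QuaternionGroup 2 × ZMod n) :=
    { toFun := fun x => (quatRotation x.1, w * x.2)
      invFun := fun x => (quatRotation (quatRotation x.1), w * (w * x.2))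
      left_inv := fun x => by
        ext1
        · exact quatRotation_pow_three x.1
        · linear_combination x.2 * hw3
      right_inv := fun x => by
        ext1
        · exact quatRotation_pow_three x.1
        · linear_combination x.2 * hw3 }
  have hf : ∀ i x, f (step w i x) = step w (i + 2) (f x) := by
    intro i x
    ext1
    · simp only [f, step, Equiv.coe_fn_mk, quatRotation_mul, quatRotation_letterQuat]
    · simp only [f, step, Equiv.coe_fn_mk, letterPos_add_two hw, mul_add]
  have h1 : f (1, 0) = (1, 0) := by
    have : quatRotation 1 = 1 := by decide
    ext1
    · exact this
    · exact mul_zero w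
  refine ⟨hexIso (w := w) f 2 hf, h1, fun i => ?_⟩
  have := hf i (1, 0)
  rwa [h1] at this

theorem exists_map_arc (hw : w ^ 2 + w + 1 = 0) (x : QuaternionGroup 2 × ZMod n) (i : Fin 6)
    (hi : i.val % 2 = 0) : ∃ φ : hexGraph w ≃g hexGraph w, φ (1, 0) = x ∧
      φ (step w 0 (1, 0)) = step w i x := by
  obtain ⟨τ, h1, h2⟩ := exists_translation (w := w) x
  obtain ⟨ρ, h3, h4⟩ := exists_rotation hw
  have hi' : i = 0 ∨ i = 2 ∨ i = 4 := by revert i; decide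
  rcases hi' with rfl | rfl | rfl
  · exact ⟨τ, h1, h2 0⟩
  · refine ⟨ρ.trans τ, by simp [h3, h1], ?_⟩
    simp [h4, h2]
  · refine ⟨(ρ.trans ρ).trans τ, by simp [h3, h1], ?_⟩
    simp only [RelIso.trans_apply, h4, h2]
    rfl

theorem isCanonicalOrientation_hexArc [NeZero n] (hw : w ^ 2 + w + 1 = 0) (hn : Odd n)
    (h3 : 3 < n) : IsCanonicalOrientation (hexGraph w) (hexArc w) where
  adj_iff x y := by
    rw [hexGraph_adj]
    have par : ∀ i : Fin 6, i.val % 2 ≠ 0 → (i + 3).val % 2 = 0 := by decide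
    constructor
    · rintro ⟨i, rfl⟩
      by_cases hi : i.val % 2 = 0
      · exact Or.inl ⟨i, hi, rfl⟩
      · exact Or.inr ⟨i + 3, par i hi, (step_add_three w i x).symm⟩
    · rintro (⟨i, -, rfl⟩ | ⟨i, -, rfl⟩)
      · exact ⟨i, rfl⟩
      · exact ⟨i + 3, (step_add_three w i y).symm⟩
  asymm := by
    rintro x y ⟨i, hi, rfl⟩ ⟨j, hj, h⟩
    have h4 : step w j (step w i x) = step w (i + 3) (step w i x) := by
      rw [← h, step_add_three]
    rw [step_inj hw hn h3] at h4
    subst h4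
    revert i
    simp only [imp_false]
    have : ∀ i : Fin 6, i.val % 2 = 0 → ¬ (i + 3).val % 2 = 0 := by decide
    intro i hi hj _
    exact this i hi hj
  map := hexArc_map hw hn h3
  trans := by
    rintro x y x' y' ⟨i, hi, rfl⟩ ⟨j, hj, rfl⟩
    obtain ⟨φ, h1, h2⟩ := exists_map_arc hw x i hi
    obtain ⟨ψ, h4, h5⟩ := exists_map_arc hw x' j hj
    refine ⟨φ.symm.trans ψ, ?_, ?_⟩
    · rw [← h1, ← h4]; simp
    · rw [← h2, ← h5]; simp
  out x := ⟨step w 0 x, 0, rfl, rfl⟩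

end hexGraph

/-! ### Classes of the reachability relation -/

section hexReachability

variable {n : ℕ} {w : ZMod n}

theorem reflTransGen_step_step (i j : Fin 6) (hi : i.val % 2 = 0) (hj : j.val % 2 = 0)
    (x : QuaternionGroup 2 × ZMod n) :
    Relation.ReflTransGen (SharesHead (hexArc w)) x (step w (j + 3) (step w i x)) := by
  refine Relation.ReflTransGen.single ⟨step w i x, ⟨i, hi, rfl⟩, ⟨j, hj, ?_⟩⟩
  have := step_add_three w (j + 3) (step w i x)
  rw [add_three_add_three] at this
  exact this.symm

/-- Following letter 0 and then the inverse of letter 2 moves by 1 - w. Its Q₈-part has order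
dividing 4 and 4 is invertible, so every multiple of 1 - w is attained without changing the
Q₈-component. -/
theorem reflTransGen_add (hn : Odd n) [NeZero n] (x : QuaternionGroup 2 × ZMod n) (c : ZMod n) :
    Relation.ReflTransGen (SharesHead (hexArc w)) x (x.1, x.2 + (1 - w) * c) := by
  have h1 : ∀ k : ℕ, Relation.ReflTransGen (SharesHead (hexArc w)) x
      (x.1 * (letterQuat 0 * letterQuat 5) ^ k, x.2 + k * (1 - w)) := by
    intro k
    induction k with
    | zero => simpa using Relation.ReflTransGen.refl
    | succ k ih =>
      refine ih.trans ?_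
      convert reflTransGen_step_step 0 2 rfl rfl _ using 1
      ext1
      · simp only [step, pow_succ, mul_assoc]
        rfl
      · simp [step, letterPos, letterRe, letterIm]
        ring
  obtain ⟨u, hu⟩ := isUnit_four hn
  have h2 := h1 (4 * (↑u⁻¹ * c : ZMod n).val)
  have h4 : (letterQuat 0 * letterQuat 5) ^ 4 = 1 := by decide
  rw [pow_mul, h4, one_pow, mul_one] at h2
  convert h2 using 2
  push_cast
  rw [ZMod.natCast_val, ZMod.cast_id, ← hu, ← mul_assoc, Units.mul_inv, one_mul, mul_comm]

theorem reflTransGen_of_eq (hw : w ^ 2 + w + 1 = 0) (hn : Odd n) [NeZero n]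
    (x y : QuaternionGroup 2 × ZMod n) (c : ZMod n) (h : y.2 = x.2 + (1 - w) * c) :
    Relation.ReflTransGen (SharesHead (hexArc w)) x y := by
  -- The quaternions attainable together with an arbitrary shift in (1 - w)ℤ/n; two explicit
  -- elements generate all of Q₈.
  let S : Submonoid (QuaternionGroup 2) :=
    { carrier := {g | ∀ (x : QuaternionGroup 2 × ZMod n) (c : ZMod n),
        Relation.ReflTransGen (SharesHead (hexArc w)) x (x.1 * g, x.2 + (1 - w) * c)}
      one_mem' := fun x c => by
        rw [mul_one]
        exact reflTransGen_add hn x c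
      mul_mem' := fun {g g'} hg hg' x c => by
        have := (hg x 0).trans (hg' _ c)
        simpa [mul_assoc] using this }
  have hS : ∀ i j : Fin 6, i.val % 2 = 0 → j.val % 2 = 0 →
      (∃ d : ZMod n, letterPos w i + letterPos w (j + 3) = (1 - w) * d) →
      letterQuat i * letterQuat (j + 3) ∈ S := by
    rintro i j hi hj ⟨d, hd⟩ x c
    refine (reflTransGen_step_step i j hi hj x).trans ?_
    convert reflTransGen_add hn _ (c - d) using 2
    · simp only [step, mul_assoc]
    · simp only [step]
      linear_combination -hd
  have h1 := hS 0 2 rfl rfl ⟨1, by simp [letterPos, letterRe, letterIm]; ring⟩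
  have h2 := hS 2 4 rfl rfl ⟨w, by
    simp [letterPos, letterRe, letterIm]
    linear_combination hw⟩
  have h3 : ∀ g, ∃ k l : Fin 4, g = (letterQuat 0 * letterQuat (2 + 3)) ^ (k : ℕ) *
      (letterQuat 2 * letterQuat (4 + 3)) ^ (l : ℕ) := by decide +kernel
  have h4 : ∀ g, g ∈ S := by
    intro g
    obtain ⟨k, l, rfl⟩ := h3 g
    exact S.mul_mem (S.pow_mem h1 k) (S.pow_mem h2 l)
  have := h4 (x.1⁻¹ * y.1) x c
  rwa [mul_inv_cancel_left, ← h] at this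

theorem reflTransGen_of_not_dvd (hw : w ^ 2 + w + 1 = 0) (hn : Odd n) [NeZero n] (h3 : ¬ 3 ∣ n)
    (x y : QuaternionGroup 2 × ZMod n) :
    Relation.ReflTransGen (SharesHead (hexArc w)) x y := by
  have hu : IsUnit (3 : ZMod n) := by
    have : IsUnit ((3 : ℕ) : ZMod n) := by
      rw [ZMod.isUnit_iff_coprime]
      exact (Nat.Prime.coprime_iff_not_dvd Nat.prime_three).2 h3
    simpa using this
  obtain ⟨u, hu⟩ := hu.exists_right_inv
  -- Here u is the inverse of 3, and (1 - w)(2 + w) = 3.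
  refine reflTransGen_of_eq hw hn x y ((2 + w) * u * (y.2 - x.2)) ?_
  linear_combination (x.2 - y.2) * hu + (u * (y.2 - x.2)) * hw

/-- The class modulo three of a vertex of `hexGraph`. -/
def hexColour (h3 : 3 ∣ n) (x : QuaternionGroup 2 × ZMod n) : ZMod 3 :=
  ZMod.castHom h3 (ZMod 3) x.2

theorem hexColour_surjective (h3 : 3 ∣ n) : Function.Surjective (hexColour h3) := by
  intro c
  obtain ⟨p, hp⟩ := ZMod.ringHom_surjective (ZMod.castHom h3 (ZMod 3)) c
  exact ⟨(1, p), hp⟩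

theorem hexColour_of_hexArc (hw : w ^ 2 + w + 1 = 0) (h3 : 3 ∣ n)
    {x y : QuaternionGroup 2 × ZMod n} (h : hexArc w x y) :
    hexColour h3 y = hexColour h3 x + 1 := by
  obtain ⟨i, hi, rfl⟩ := h
  have h1 : ZMod.castHom h3 (ZMod 3) w = 1 := by
    have h2 : ∀ v : ZMod 3, v ^ 2 + v + 1 = 0 → v = 1 := by decide
    apply h2
    rw [← map_pow, ← map_add, ← map_one (ZMod.castHom h3 (ZMod 3)), ← map_add, hw, map_zero]
  have h4 : ∀ i : Fin 6, i.val % 2 = 0 →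
      ((letterRe i : ℤ) : ZMod 3) + (letterIm i : ℤ) * 1 = 1 := by decide
  simp only [hexColour, step, letterPos, map_add, map_mul, map_intCast, h1, h4 i hi]

theorem reflTransGen_iff_hexColour (hw : w ^ 2 + w + 1 = 0) (hn : Odd n) [NeZero n] (h3 : 3 ∣ n)
    (x y : QuaternionGroup 2 × ZMod n) :
    Relation.ReflTransGen (SharesHead (hexArc w)) x y ↔ hexColour h3 x = hexColour h3 y := by
  constructor
  · intro h
    induction h with
    | refl => rfl
    | tail _ h ih =>
      obtain ⟨z, h1, h2⟩ := h
      have h4 := hexColour_of_hexArc hw h3 h1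
      rw [hexColour_of_hexArc hw h3 h2] at h4
      rw [ih, add_right_cancel h4]
  · intro h
    have h1 : ((y.2 - x.2).val : ZMod 3) = 0 := by
      rw [ZMod.natCast_val, ← ZMod.castHom_apply (h := h3), map_sub, sub_eq_zero]
      exact h.symm
    rw [ZMod.natCast_eq_zero_iff] at h1
    obtain ⟨d, hd⟩ := h1
    have h2 : y.2 - x.2 = 3 * (d : ZMod n) := by
      have := congrArg (Nat.cast (R := ZMod n)) hd
      rw [ZMod.natCast_val, ZMod.cast_id] at this
      simpa using this
    refine reflTransGen_of_eq hw hn x y ((2 + w) * d) ?_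
    linear_combination h2 + d * hw

end hexReachability

/-! ### Identifying the Nest graph with the Cayley graph -/

section familyGraph

theorem two_mul_two_dvd (k : ℕ) : 2 * 2 ∣ 2 * (2 * k) := ⟨k, by ring⟩

theorem dvd_two_mul_two_mul (k : ℕ) : k ∣ 2 * (2 * k) := ⟨4, by ring⟩

/-- Reduction of the indices modulo `4`. -/
def modFour (k : ℕ) : ZMod (2 * (2 * k)) →+* ZMod (2 * 2) :=
  ZMod.castHom (two_mul_two_dvd k) _

/-- Reduction of the indices modulo the odd part. -/
def modOdd (k : ℕ) : ZMod (2 * (2 * k)) →+* ZMod k :=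
  ZMod.castHom (dvd_two_mul_two_mul k) _

theorem ext_modFour_modOdd {k : ℕ} (hk : Odd k) {i j : ZMod (2 * (2 * k))}
    (h4 : modFour k i = modFour k j) (h : modOdd k i = modOdd k j) : i = j := by
  have : NeZero (2 * (2 * k)) := ⟨by obtain ⟨l, rfl⟩ := hk; omega⟩
  rw [← sub_eq_zero]
  rw [← sub_eq_zero, ← map_sub] at h4 h
  generalize i - j = d at h4 h
  have h1 : 2 * 2 ∣ d.val := by
    rw [← ZMod.natCast_eq_zero_iff, ZMod.natCast_val]
    exact h4
  have h2 : k ∣ d.val := by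
    rw [← ZMod.natCast_eq_zero_iff, ZMod.natCast_val]
    exact h
  have h3 : 2 * 2 * k ∣ d.val :=
    Nat.Coprime.mul_dvd_of_dvd_of_dvd
      (Nat.Coprime.mul_left (Nat.coprime_two_left.2 hk) (Nat.coprime_two_left.2 hk)) h1 h2
  rw [← ZMod.val_eq_zero]
  refine Nat.eq_zero_of_dvd_of_lt h3 (lt_of_lt_of_eq d.val_lt (by ring))

open QuaternionGroup in
/-- The position in `Q₈ × ℤ/k` of a vertex of the Nest graph. -/
def nestPosition {k : ℕ} (w : ZMod k) :
    ZMod (2 * (2 * k)) ⊕ ZMod (2 * (2 * k)) → QuaternionGroup 2 × ZMod k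
  | Sum.inl i => (a (modFour k i), modOdd k i)
  | Sum.inr j => (xa (-modFour k j), modOdd k j + w ^ 2)

theorem nestPosition_injective {k : ℕ} (hk : Odd k) (w : ZMod k) :
    Function.Injective (nestPosition w) := by
  rintro (i | i) (j | j) h <;> simp [nestPosition] at h
  · rw [ext_modFour_modOdd hk h.1 h.2]
  · rw [ext_modFour_modOdd hk h.1 h.2]

theorem nestPosition_bijective {k : ℕ} (hk : Odd k) (w : ZMod k) :
    Function.Bijective (nestPosition w) := by
  have : NeZero k := ⟨by obtain ⟨l, rfl⟩ := hk; omega⟩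
  rw [Fintype.bijective_iff_injective_and_card]
  refine ⟨nestPosition_injective hk w, ?_⟩
  rw [Fintype.card_sum, Fintype.card_prod, ZMod.card, ZMod.card, QuaternionGroup.card]
  ring

section steps

variable {k : ℕ} {w : ZMod k} (i : ZMod (2 * (2 * k)))

theorem nestPosition_inl_add_one :
    nestPosition w (Sum.inl (i + 1)) = step w 0 (nestPosition w (Sum.inl i)) := by
  ext1 <;> simp [nestPosition, step, letterQuat, letterPos, letterRe, letterIm]

theorem nestPosition_inr_self (hw : w ^ 2 + w + 1 = 0) :
    nestPosition w (Sum.inr i) = step w 4 (nestPosition w (Sum.inl i)) := by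
  ext1 <;> simp [nestPosition, step, letterQuat, letterPos, letterRe, letterIm]
  linear_combination hw

theorem nestPosition_inr_add_one (hw : w ^ 2 + w + 1 = 0) :
    nestPosition w (Sum.inr (i + 1)) = step w 5 (nestPosition w (Sum.inl i)) := by
  ext1 <;> simp [nestPosition, step, letterQuat, letterPos, letterRe, letterIm]
  · generalize modFour k i = z
    revert z; decide
  · linear_combination hw

theorem natCast_eq_neg_one {b c : ℕ} (hb : b + 1 = 4 * c) : ((b : ℕ) : ZMod (2 * 2)) = -1 := by
  rw [eq_neg_iff_add_eq_zero]
  exact_mod_cast (ZMod.natCast_eq_zero_iff (b + 1) (2 * 2)).2 ⟨c, hb⟩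

theorem modFour_two_mul (hk : Odd k) : modFour k ((2 * k : ℕ) : ZMod (2 * (2 * k))) = 2 := by
  rw [map_natCast]
  obtain ⟨l, rfl⟩ := hk
  have : ∀ z : ZMod (2 * 2), 2 * (2 * z + 1) = 2 := by decide
  simpa using this l

theorem modOdd_two_mul : modOdd k ((2 * k : ℕ) : ZMod (2 * (2 * k))) = 0 := by
  simp

theorem nestPosition_inr_add {b c : ℕ} (hb : b + 1 = 4 * c) (hw : w ^ 2 + w + 1 = 0)
    (hbw : (b : ZMod k) = 2 * w + 1) :
    nestPosition w (Sum.inr (i + b)) = step w 2 (nestPosition w (Sum.inl i)) := by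
  ext1 <;> simp [nestPosition, step, letterQuat, letterPos, letterRe, letterIm,
    natCast_eq_neg_one hb, hbw]
  · generalize modFour k i = z
    revert z; decide
  · linear_combination hw

theorem nestPosition_inr_add_add {b c : ℕ} (hb : b + 1 = 4 * c) (hk : Odd k)
    (hw : w ^ 2 + w + 1 = 0) (hbw : (b : ZMod k) = 2 * w + 1) :
    nestPosition w (Sum.inr (i + (b + (2 * k : ℕ) + 1))) =
      step w 1 (nestPosition w (Sum.inl i)) := by
  simp only [nestPosition, map_add, modFour_two_mul hk, map_one, map_natCast,
    natCast_eq_neg_one hb, hbw]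
  ext1 <;> simp [step, letterQuat, letterPos, letterRe, letterIm]
  · generalize modFour k i = z
    revert z; decide
  · linear_combination hw

theorem nestPosition_inr_add_sub_one (hk : Odd k) :
    nestPosition w (Sum.inr (i + ((2 * k : ℕ) - 1))) =
      step w 3 (nestPosition w (Sum.inr i)) := by
  simp only [nestPosition, map_add, map_sub, modFour_two_mul hk, modOdd_two_mul, map_one]
  ext1 <;> simp [step, letterQuat, letterPos, letterRe, letterIm]
  · generalize modFour k i = z
    revert z; decide
  · ring

end steps

theorem eq_step_add_three {n : ℕ} {w : ZMod n} {i : Fin 6} {x y : QuaternionGroup 2 × ZMod n}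
    (h : y = step w i x) : x = step w (i + 3) y := by
  rw [h, step_add_three]

/-- The rim edges carry letters 0 and 3, and the spokes with offsets 0, 1, b, b + m + 1 carry 4, 5,
2, 1. This rests on b being -1 modulo 4 and 2w + 1 modulo k, and on m = 2k being 2 modulo 4 and 0
modulo k. -/
theorem exists_step_of_nestRel {b c k : ℕ} (hb : b + 1 = 4 * c) (hk : Odd k) {w : ZMod k}
    (hw : w ^ 2 + w + 1 = 0) (hbw : (b : ZMod k) = 2 * w + 1)
    {x y : ZMod (2 * (2 * k)) ⊕ ZMod (2 * (2 * k))}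
    (h : nestRel (2 * (2 * k)) 1 b (b + (2 * k : ℕ) + 1) ((2 * k : ℕ) - 1) x y) :
    ∃ l, nestPosition w y = step w l (nestPosition w x) := by
  rcases x with i | i <;> rcases y with j | j <;> simp only [nestRel] at h
  · subst h
    exact ⟨0, nestPosition_inl_add_one i⟩
  · rcases h with rfl | rfl | rfl | rfl
    · exact ⟨4, nestPosition_inr_self j hw⟩
    · exact ⟨5, nestPosition_inr_add_one i hw⟩
    · exact ⟨2, nestPosition_inr_add i hb hw hbw⟩
    · exact ⟨1, nestPosition_inr_add_add i hb hk hw hbw⟩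
  · subst h
    exact ⟨3, nestPosition_inr_add_sub_one i hk⟩

theorem exists_nestRel_of_step {b c k : ℕ} (hb : b + 1 = 4 * c) (hk : Odd k) {w : ZMod k}
    (hw : w ^ 2 + w + 1 = 0) (hbw : (b : ZMod k) = 2 * w + 1)
    (x : ZMod (2 * (2 * k)) ⊕ ZMod (2 * (2 * k))) (l : Fin 6) :
    ∃ y, nestPosition w y = step w l (nestPosition w x) ∧
      (nestRel (2 * (2 * k)) 1 b (b + (2 * k : ℕ) + 1) ((2 * k : ℕ) - 1) x y ∨
        nestRel (2 * (2 * k)) 1 b (b + (2 * k : ℕ) + 1) ((2 * k : ℕ) - 1) y x) := by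
  have hl : l = 0 ∨ l = 1 ∨ l = 2 ∨ l = 3 ∨ l = 4 ∨ l = 5 := by revert l; decide
  rcases x with i | i
  · rcases hl with rfl | rfl | rfl | rfl | rfl | rfl
    · exact ⟨_, nestPosition_inl_add_one i, Or.inl rfl⟩
    · exact ⟨_, nestPosition_inr_add_add i hb hk hw hbw, Or.inl (Or.inr (Or.inr (Or.inr rfl)))⟩
    · exact ⟨_, nestPosition_inr_add i hb hw hbw, Or.inl (Or.inr (Or.inr (Or.inl rfl)))⟩
    · have h := eq_step_add_three (nestPosition_inl_add_one (w := w) (i - 1))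
      rw [sub_add_cancel] at h
      exact ⟨_, h, Or.inr (sub_add_cancel i 1).symm⟩
    · exact ⟨_, nestPosition_inr_self i hw, Or.inl (Or.inl rfl)⟩
    · exact ⟨_, nestPosition_inr_add_one i hw, Or.inl (Or.inr (Or.inl rfl))⟩
  · rcases hl with rfl | rfl | rfl | rfl | rfl | rfl
    · have h := eq_step_add_three (nestPosition_inr_add_sub_one (w := w)
        (i - ((2 * k : ℕ) - 1)) hk)
      rw [sub_add_cancel] at h
      exact ⟨_, h, Or.inr (sub_add_cancel i _).symm⟩
    · exact ⟨_, eq_step_add_three (nestPosition_inr_self i hw), Or.inr (Or.inl rfl)⟩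
    · have h := eq_step_add_three (nestPosition_inr_add_one (i - 1) hw)
      rw [sub_add_cancel] at h
      exact ⟨_, h, Or.inr (Or.inr (Or.inl (sub_add_cancel i 1).symm))⟩
    · exact ⟨_, nestPosition_inr_add_sub_one i hk, Or.inl rfl⟩
    · have h := eq_step_add_three (nestPosition_inr_add_add
        (i - ((b : ZMod (2 * (2 * k))) + ((2 * k : ℕ) : ZMod (2 * (2 * k))) + 1)) hb hk hw hbw)
      rw [sub_add_cancel] at h
      exact ⟨_, h, Or.inr (Or.inr (Or.inr (Or.inr (sub_add_cancel i _).symm)))⟩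
    · have h := eq_step_add_three (nestPosition_inr_add
        (i - (b : ZMod (2 * (2 * k)))) hb hw hbw)
      rw [sub_add_cancel] at h
      exact ⟨_, h, Or.inr (Or.inr (Or.inr (Or.inl (sub_add_cancel i _).symm)))⟩

theorem adj_nestPosition_iff {b c k : ℕ} (hb : b + 1 = 4 * c) (hk : Odd k) {w : ZMod k}
    (hw : w ^ 2 + w + 1 = 0) (hbw : (b : ZMod k) = 2 * w + 1)
    (x y : ZMod (2 * (2 * k)) ⊕ ZMod (2 * (2 * k))) :
    (hexGraph w).Adj (nestPosition w x) (nestPosition w y) ↔ (familyGraph b (2 * k)).Adj x y := by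
  simp only [familyGraph, nestGraph, SimpleGraph.fromRel_adj]
  constructor
  · intro h
    refine ⟨fun hxy => (hexGraph w).ne_of_adj h (congrArg _ hxy), ?_⟩
    obtain ⟨l, hl⟩ := h
    obtain ⟨y', hy, hr⟩ := exists_nestRel_of_step hb hk hw hbw x l
    rwa [nestPosition_injective hk w (hl.trans hy.symm)]
  · rintro ⟨-, h | h⟩
    · exact exists_step_of_nestRel hb hk hw hbw h
    · exact SimpleGraph.Adj.symm (exists_step_of_nestRel hb hk hw hbw h)

/-- The graph of the family is isomorphic to a Cayley graph of `Q₈ × ℤ/k`. -/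
theorem exists_iso_hexGraph {b₀ b m : ℕ} (h : IsAdmissible b₀ b m) :
    ∃ (k : ℕ) (w : ZMod k), Odd k ∧ 3 < k ∧ m = 2 * k ∧ w ^ 2 + w + 1 = 0 ∧
      Nonempty (familyGraph b m ≃g hexGraph w) := by
  obtain ⟨h1, h2, h3, -, h4, h5, h6⟩ := h
  obtain ⟨k, rfl, hk⟩ : ∃ k, m = 2 * k ∧ Odd k := by
    have h7 : m % 4 = 2 := h5
    exact ⟨m / 2, by omega, Nat.odd_iff.2 (by omega)⟩
  have hb : b + 1 = 4 * b₀ := by omega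
  have hb0 : (b : ZMod k) = 2 * (2 * (b₀ : ZMod k) - 1) + 1 := by
    have := congrArg (Nat.cast (R := ZMod k)) hb
    push_cast at this
    linear_combination this
  have hw : (2 * (b₀ : ZMod k) - 1) ^ 2 + (2 * (b₀ : ZMod k) - 1) + 1 = 0 := by
    have h7 : ((b ^ 2 + 3 : ℕ) : ZMod k) = 0 :=
      (ZMod.natCast_eq_zero_iff _ _).2 ((Dvd.intro_left 2 rfl).trans h4)
    push_cast at h7
    rw [hb0] at h7
    apply (isUnit_four hk).mul_left_cancel
    linear_combination h7
  -- For m = 6 the bounds leave b = 7 or b = 11, and 6 divides neither 52 nor 124.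
  have hk3 : k ≠ 3 := by
    rintro rfl
    have h8 : b = 7 ∨ b = 11 := by omega
    rcases h8 with rfl | rfl <;> omega
  refine ⟨k, 2 * (b₀ : ZMod k) - 1, hk, ?_, rfl, hw,
    ⟨Equiv.ofBijective _ (nestPosition_bijective hk (2 * (b₀ : ZMod k) - 1)),
      fun {x y} => adj_nestPosition_iff hb hk hw hb0 x y⟩⟩
  obtain ⟨l, rfl⟩ := hk
  omega

theorem familyGraph_properties {b₀ b m : ℕ} (h : IsAdmissible b₀ b m) :
    IsHalfArcTransitive (familyGraph b m) ∧
      HasValence (familyGraph b m) 6 ∧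
      ∀ D : ZMod (2 * m) ⊕ ZMod (2 * m) → ZMod (2 * m) ⊕ ZMod (2 * m) → Prop,
        IsInducedOrientation (familyGraph b m) D →
          Equivalence (Reachable (familyGraph b m) D) ∧
          (IsReachabilityUniversal (familyGraph b m) D ↔ ¬ 3 ∣ m) ∧
          (3 ∣ m → (alternets (familyGraph b m) D).ncard = 3) := by
  obtain ⟨k, w, hk, h3, hm, hw, ⟨e⟩⟩ := exists_iso_hexGraph h
  have : NeZero k := ⟨by omega⟩
  have hD := (isCanonicalOrientation_hexArc hw hk h3).comap e
  have hdvd : 3 ∣ m ↔ 3 ∣ k := by omega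
  refine ⟨hD.isHalfArcTransitive, fun x => ?_, fun D hind => ?_⟩
  · rw [← ncard_neighborSet_hexGraph hw hk h3 (e x), ← Set.ncard_image_of_injective _ e.injective]
    congr 1
    ext y
    simp only [Set.mem_image, SimpleGraph.mem_neighborSet]
    constructor
    · rintro ⟨z, hz, rfl⟩
      exact e.map_adj_iff.2 hz
    · intro hy
      exact ⟨e.symm y, e.map_adj_iff.1 (by simpa using hy), by simp⟩
  · have hreach := hD.reachable_eq hind
    have halt : alternets (familyGraph b m) D =
        alternets (familyGraph b m) fun x y => hexArc w (e x) (e y) := by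
      simp only [alternets, hreach]
    have hgen := reflTransGen_sharesHead_comap (hexArc w) e.toEquiv
    refine ⟨?_, ?_, fun h3m => ?_⟩
    · rw [hreach]
      exact hD.equivalence_reachable
    · have huniv : IsReachabilityUniversal (familyGraph b m) D ↔
          IsReachabilityUniversal (familyGraph b m) fun x y => hexArc w (e x) (e y) := by
        simp only [IsReachabilityUniversal, hreach]
      rw [huniv, hD.universal_iff, hdvd]
      constructor
      · intro hall h3k
        obtain ⟨x, hx⟩ := hexColour_surjective h3k 0
        obtain ⟨y, hy⟩ := hexColour_surjective h3k 1
        have h4 := (hgen _ _).1 (hall (e.symm x) (e.symm y))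
        rw [reflTransGen_iff_hexColour hw hk h3k] at h4
        change hexColour h3k (e (e.symm x)) = hexColour h3k (e (e.symm y)) at h4
        rw [e.apply_symm_apply, e.apply_symm_apply, hx, hy] at h4
        exact absurd h4 (by decide)
      · intro h3k x y
        exact (hgen x y).2 (reflTransGen_of_not_dvd hw hk h3k _ _)
    · have h3k := hdvd.1 h3m
      rw [halt, hD.ncard_alternets (fun x => hexColour h3k (e x))
        ((hexColour_surjective h3k).comp e.surjective)
        (fun x y => (hgen x y).trans (reflTransGen_iff_hexColour hw hk h3k _ _))]
      simp

/-! ### Infinitely many universal members -/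

theorem exists_isAdmissible (N : ℕ) :
    ∃ b₀ b m : ℕ, IsAdmissible b₀ b m ∧ N < m ∧ ¬ 3 ∣ m := by
  obtain ⟨t, ht⟩ : ∃ t, t = N + 1 := ⟨_, rfl⟩
  -- Naming the square makes the remaining inequalities and congruences linear.
  obtain ⟨r, hr⟩ : ∃ r, r = t * t := ⟨_, rfl⟩
  have hrt : t ≤ r := by rw [hr]; exact Nat.le_mul_of_pos_left t (by omega)
  -- With b = 12t - 1 one has b² + 3 = 4(36t² - 6t + 1) = 2m, and m/2 is odd and 1 modulo 3.
  refine ⟨3 * t, 12 * t - 1, 2 * (36 * r - 6 * t + 1), ⟨by omega, by push_cast; omega, by omega,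
    ⟨36 * r - 6 * t + 1, by ring⟩, ⟨2, ?_⟩, ?_, by omega⟩, by omega, by omega⟩
  · zify [show 1 ≤ 12 * t by omega, show 6 * t ≤ 36 * r by omega]
    rw [hr]
    push_cast
    ring
  · change _ % 4 = 2 % 4
    obtain ⟨v, hv⟩ : ∃ v, 36 * r - 6 * t = 2 * v := ⟨18 * r - 3 * t, by omega⟩
    omega

end familyGraph

theorem theorem4p12 :
    (∀ b₀ b m : ℕ, IsAdmissible b₀ b m →
      IsHalfArcTransitive (familyGraph b m) ∧
      HasValence (familyGraph b m) 6 ∧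
      ∀ D : ZMod (2 * m) ⊕ ZMod (2 * m) → ZMod (2 * m) ⊕ ZMod (2 * m) → Prop,
        IsInducedOrientation (familyGraph b m) D →
          Equivalence (Reachable (familyGraph b m) D) ∧
          (IsReachabilityUniversal (familyGraph b m) D ↔ ¬ 3 ∣ m) ∧
          (3 ∣ m → (alternets (familyGraph b m) D).ncard = 3)) ∧
    (∀ N : ℕ, ∃ b₀ b m : ℕ, IsAdmissible b₀ b m ∧
      N < Nat.card (ZMod (2 * m) ⊕ ZMod (2 * m)) ∧
      IsHalfArcTransitive (familyGraph b m) ∧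
      HasValence (familyGraph b m) 6 ∧
      ∀ D : ZMod (2 * m) ⊕ ZMod (2 * m) → ZMod (2 * m) ⊕ ZMod (2 * m) → Prop,
        IsInducedOrientation (familyGraph b m) D →
          IsReachabilityUniversal (familyGraph b m) D) := by
  refine ⟨fun b₀ b m h => familyGraph_properties h, fun N => ?_⟩
  obtain ⟨b₀, b, m, h, hN, h3⟩ := exists_isAdmissible N
  obtain ⟨h1, h2, h4⟩ := familyGraph_properties h
  refine ⟨b₀, b, m, h, ?_, h1, h2, fun D hD => (h4 D hD).2.1.2 h3⟩
  have : NeZero (2 * m) := ⟨by omega⟩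
  rw [Nat.card_sum, Nat.card_zmod]
  omega
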